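/- **Setting.** For $n\ge 1$ let $X^n$ be a continuous time Markov chain on a countable set $E^n\subset\mathbb R^d$ with jump rates $q^n_{x,y}$ ($x\ne y$), $\sum_{y\neq x}q^n_{x,y}<\infty$; write $\beta^n_\ell(x)=q^n_{x,x+\ell}$. Let $F^n:\mathbb R^d\to\mathbb R^d$ and $a^n:\mathbb R^d\to\mathbb R^{d\times d}$ be extensions of $F^n(x)=\sum_\ell \ell\,\beta^n_\ell(x)$ and $a^n_{ij}(x)=\sum_\ell \ell_i\ell_j\,\beta^n_\ell(x)$, $x\in E^n$. Assume that $F^n$ has a unique zero $\bar x^n_\infty$, and put $$\widehat X^n=\frac{X^n-\bar x^n_\infty}{\sqrt n},\qquad \widehat F^n(x)=\frac{F^n(\bar x^n_\infty+\sqrt n\,x)}{\sqrt n},\qquad \bar a^n(x)=\frac{a^n(\bar x^n_\infty+\sqrt n\,x)}{n},$$ and let $\widehat E^n$ be the state space of $\widehat X^n$. Let $\bar\ell$ be the supremum over all $n$ of the sizes $|\ell|$ of the jumps that $X^n$ makes at a positive rate; throughout, $n$ is large enough that $\bar\ell/\sqrt n\le 1$. **Assumption 1.** $\bar\ell<\infty$;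 for each $n$, $X^n$ is nonexplosive, irreducible and positive recurrent; there are constants $K_F,K_a$ such that for all $n$ and all $x,y\in\mathbb R^d$, $|\widehat F^n(x)-\widehat F^n(y)|\le K_F|x-y|$ and $|\bar a^n(x)-\bar a^n(0)|\le K_a|x|/\sqrt n$; each $\bar a^n(0)$ is positive definite, and $\bar a^n(0)\to\bar a$ for a positive definite matrix $\bar a$. Let $\nu^n$ be the steady-state distribution of $\widehat X^n$: the probability distribution on $\widehat E^n$ such that $\mathbb E_x[f(\widehat X^n(t))]\to\nu^n(f)$ as $t\to\infty$ for all $x\in\widehat E^n$ and all bounded continuous $f$. For $f\in C^2(\mathbb R^d)$ let $$\mathcal A^nf(x)=\sum_{i}\widehat F^n_i(x)\,\partial_i f(x)+\frac12\sum_{i,j}\bar a^n_{ij}(0)\,\partial_{ij}f(x).$$ **Assumption 2** (on a function $V$). $V\in C^2(\mathbb R^d)$, $V\ge1$, $V(x)\to\infty$ as $|x|\to\infty$; there are constants $c_1,c_2,c_3$ with $|DV(x)|\vee|D^2V(x)|\le c_1e^{c_2|x|}$ and $\sup_{|y|\le1}V(x+y)/V(x)\le c_3$ for all $x$; there are constants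 $b,\delta,K>0$ such that for all $n$ and all $x\in\mathbb R^d$ $$\mathcal A^nV(x)\le-\delta V(x)+b\,\mathbf 1_{\{|x|\le K\}};$$ and for each $n$, all $x\in\widehat E^n$ and all $t\ge0$, $\mathbb E_x\big[\int_0^t\big((1+|\widehat X^n(s)|)^4\,V(\widehat X^n(s))\big)^2ds\big]<\infty$. **Derivative condition** (on a function $V$). There is a constant $C>0$ such that for each $n$ and all $x\in\mathbb R^d$ $$\big(|DV(x)|+|D^2V(x)|+[V]_{2,1,B_x(\bar\ell/\sqrt n)}\big)(1+|x|)\le C\,V(x),\qquad [V]_{2,1,B}=\sup_{y,z\in B,\ y\ne z}\frac{|D^2V(y)-D^2V(z)|}{|y-z|}\in[0,\infty],$$ where $B_x(r)$ is the open ball of radius $r$ around $x$. **Corollary.** Let Assumption 1 hold. Suppose that $V$ satisfies Assumption 2, that $\bar V$ satisfies Assumption 2 and the derivative condition, and that $V(x)(1+|x|)^4\le\bar V(x)$ for all $x\in\mathbb R^d$. Then $$\limsup_{n\to\infty}\nu^n(\bar V)<\infty\qquad\text{and, in particular,}\qquad \limsup_{n\to\infty}\nu^n\big(V(\cdot)(1+|\cdot|)^4\big)<\infty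 .$$ -/

import Mathlib

open scoped NNReal ENNReal Topology

/-! ## Continuous time Markov chains on a countable state space

`q x y` is the rate of jumps from `x` to `y`, for `y ≠ x`; the diagonal entries of `q` are never
used. -/

namespace CTMC

variable {S : Type*}

open Classical in
/-- The off-diagonal part of a matrix of jump rates. -/
noncomputable def offDiag (q : S → S → ℝ≥0) (x y : S) : ℝ≥0∞ :=
  if y = x then 0 else (q x y : ℝ≥0∞)

/-- The total rate at which the chain leaves `x`. -/
noncomputable def exitRate (q : S → S → ℝ≥0) (x : S) : ℝ≥0∞ := ∑' y, offDiag q x y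

open Classical in
/-- `transIter q k t x y` is the probability that the chain with rates `q`, started at `x`, is at `y`
at time `t` and has made fewer than `k` jumps by then. The recursion conditions on the time `s` and
the target `z` of the first jump. -/
noncomputable def transIter (q : S → S → ℝ≥0) : ℕ → ℝ → S → S → ℝ≥0∞
  | 0 => fun _ _ _ => 0
  | k + 1 => fun t x y =>
      (if x = y then ENNReal.ofReal (Real.exp (-((exitRate q x).toReal * t))) else 0) +
        ∫⁻ s in Set.Icc (0 : ℝ) t, ENNReal.ofReal (Real.exp (-((exitRate q x).toReal * s))) *
          ∑' z, offDiag q x z * transIter q k (t - s) z y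

/-- The transition function `p_t(x, y) = P_x(X(t) = y)` of the chain with rates `q`: the minimal
nonnegative solution of Kolmogorov's backward equation. -/
noncomputable def trans (q : S → S → ℝ≥0) (t : ℝ) (x y : S) : ℝ≥0∞ := ⨆ k, transIter q k t x y

/-- No explosion: from every starting point, almost surely only finitely many jumps occur in finite
time. -/
def NonExplosive (q : S → S → ℝ≥0) : Prop :=
  ∀ t : ℝ, 0 ≤ t → ∀ x, ∑' y, trans q t x y = 1

/-- Every state can be reached from every state. -/
def Irreducible (q : S → S → ℝ≥0) : Prop :=
  ∀ x y, ∃ t : ℝ, 0 ≤ t ∧ 0 < trans q t x y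

open Classical in
/-- `hitIter q x k z` is `E_z[min(T, J_k)]`, where `J_k` is the time of the `k`-th jump and `T` is the
time of the first jump into `x`. -/
noncomputable def hitIter (q : S → S → ℝ≥0) (x : S) : ℕ → S → ℝ≥0∞
  | 0 => fun _ => 0
  | k + 1 => fun z => (exitRate q z)⁻¹ +
      ∑' w, if w = x then 0 else offDiag q z w / exitRate q z * hitIter q x k w

/-- The expected first return time to `x` (of a non-explosive chain started at `x`). -/
noncomputable def meanReturnTime (q : S → S → ℝ≥0) (x : S) : ℝ≥0∞ := ⨆ k, hitIter q x k x

/-- Every state is positive recurrent: absorbing or with finite expected return time. -/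
def PositiveRecurrent (q : S → S → ℝ≥0) : Prop :=
  ∀ x, exitRate q x = 0 ∨ meanReturnTime q x < ∞

end CTMC

/-- The space `ℝ^d` with the Euclidean norm. -/
abbrev Euc (d : ℕ) : Type := EuclideanSpace ℝ (Fin d)

/-- The data of a sequence of chains `X^n` in `ℝ^d`: the state spaces `E^n`, the jump rates, the
extensions of the drift `F^n` and of the quadratic variation density `a^n` to `ℝ^d`, and the
stationary points of the fluid models. The index `n = 0` plays no role. -/
structure ChainSeq (d : ℕ) where
  /-- the state spaces `E^n` -/
  E : ℕ → Set (Euc d)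
  /-- the jump rates `q^n_{x,y}` -/
  rate : (n : ℕ) → E n → E n → ℝ≥0
  /-- the drifts `F^n`, extended to `ℝ^d` -/
  F : ℕ → Euc d → Euc d
  /-- the quadratic variation densities `a^n`, extended to `ℝ^d` -/
  a : ℕ → Euc d → Matrix (Fin d) (Fin d) ℝ
  /-- the stationary points of the fluid models -/
  xbar : ℕ → Euc d

namespace ChainSeq

open MeasureTheory

variable {d : ℕ}

/-- The sizes of all jumps that occur (at a positive rate) in one of the chains. -/
def jumpSizes (M : ChainSeq d) : Set ℝ :=
  {r | ∃ n : ℕ, 1 ≤ n ∧ ∃ x y : M.E n, y ≠ x ∧ 0 < M.rate n x y ∧ r = ‖(y : Euc d) - (x : Euc d)‖}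

/-- The maximal jump size `ℓ̄`. -/
noncomputable def jumpBound (M : ChainSeq d) : ℝ := sSup M.jumpSizes

/-- The indices under consideration: `n` is so large that `ℓ̄ / √n ≤ 1`. -/
def Index (M : ChainSeq d) (n : ℕ) : Prop := 1 ≤ n ∧ M.jumpBound / √(n : ℝ) ≤ 1

/-- Centering and scaling of a point: `x ↦ (x - x̄^n_∞) / √n`. -/
noncomputable def scale (M : ChainSeq d) (n : ℕ) (x : Euc d) : Euc d :=
  (√(n : ℝ))⁻¹ • (x - M.xbar n)

/-- The state space of the centered and scaled chain. -/
def Ehat (M : ChainSeq d) (n : ℕ) : Set (Euc d) := M.scale n '' M.E n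

/-- The scaled drift. -/
noncomputable def Fhat (M : ChainSeq d) (n : ℕ) (x : Euc d) : Euc d :=
  (√(n : ℝ))⁻¹ • M.F n (M.xbar n + √(n : ℝ) • x)

/-- The scaled quadratic variation density. -/
noncomputable def abar (M : ChainSeq d) (n : ℕ) (x : Euc d) : Matrix (Fin d) (Fin d) ℝ :=
  (n : ℝ)⁻¹ • M.a n (M.xbar n + √(n : ℝ) • x)

/-- The law at time `t` of the centered and scaled chain, when the unscaled chain starts at `x`. -/
noncomputable def law (M : ChainSeq d) (n : ℕ) (t : ℝ) (x : M.E n) : Measure (Euc d) :=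
  Measure.sum fun y : M.E n => CTMC.trans (M.rate n) t x y • Measure.dirac (M.scale n y)

/-- `ν` is the steady-state distribution of the `n`-th centered and scaled chain: it is a probability
distribution on the state space, and `E_x[f(X(t))]` tends to `ν(f)` for all starting points `x` and
all bounded continuous `f`. -/
structure IsSteadyState (M : ChainSeq d) (n : ℕ) (ν : Measure (Euc d)) : Prop where
  prob : IsProbabilityMeasure ν
  supported : ν (M.Ehat n)ᶜ = 0
  tendsto : ∀ (x : M.E n) (f : BoundedContinuousFunction (Euc d) ℝ),
    Filter.Tendsto (fun t : ℝ => ∫ u, f u ∂(M.law n t x)) Filter.atTop (𝓝 (∫ u, f u ∂ν))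

open scoped Matrix.Norms.Frobenius in
/-- The standing assumptions on the sequence of chains. -/
structure Base (M : ChainSeq d) : Prop where
  countable : ∀ n, M.Index n → (M.E n).Countable
  exitRate_lt_top : ∀ n, M.Index n → ∀ x, CTMC.exitRate (M.rate n) x < ∞
  nonExplosive : ∀ n, M.Index n → CTMC.NonExplosive (M.rate n)
  irreducible : ∀ n, M.Index n → CTMC.Irreducible (M.rate n)
  positiveRecurrent : ∀ n, M.Index n → CTMC.PositiveRecurrent (M.rate n)
  boundedJumps : BddAbove M.jumpSizes
  /-- `F^n(x) = ∑_ℓ ℓ β^n_ℓ(x)` on the state space -/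
  drift : ∀ n, M.Index n → ∀ x : M.E n,
    HasSum (fun y : M.E n => (M.rate n x y : ℝ) • ((y : Euc d) - (x : Euc d))) (M.F n x)
  /-- `a^n_{ij}(x) = ∑_ℓ ℓ_i ℓ_j β^n_ℓ(x)` on the state space -/
  quadVar : ∀ n, M.Index n → ∀ (x : M.E n) (i j : Fin d),
    HasSum (fun y : M.E n => (M.rate n x y : ℝ) *
      (((y : Euc d) i - (x : Euc d) i) * ((y : Euc d) j - (x : Euc d) j))) (M.a n x i j)
  /-- `x̄^n_∞` is the unique zero of `F^n` -/
  stationary : ∀ n, M.Index n → ∀ x, M.F n x = 0 ↔ x = M.xbar n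
  lipschitz : ∃ KF : ℝ, ∀ n, M.Index n → ∀ x y, ‖M.Fhat n x - M.Fhat n y‖ ≤ KF * ‖x - y‖
  linearGrowth : ∃ Ka : ℝ, ∀ n, M.Index n → ∀ x,
    ‖M.abar n x - M.abar n 0‖ ≤ Ka / √(n : ℝ) * ‖x‖
  posDef : ∀ n, M.Index n → (M.abar n 0).PosDef
  limit : ∃ abarLim : Matrix (Fin d) (Fin d) ℝ, abarLim.PosDef ∧
    Filter.Tendsto (fun n => M.abar n 0) Filter.atTop (𝓝 abarLim)

/-- The generator of the `n`-th diffusion model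
`dY(t) = F̂^n(Y(t)) dt + √(ā^n(0)) dB(t)`, on functions of class `C²`. -/
noncomputable def gen (M : ChainSeq d) (n : ℕ) (f : Euc d → ℝ) (x : Euc d) : ℝ :=
  ∑ i, M.Fhat n x i * fderiv ℝ f x (EuclideanSpace.single i 1) +
    1 / 2 * ∑ i, ∑ j, M.abar n 0 i j *
      fderiv ℝ (fderiv ℝ f) x (EuclideanSpace.single i 1) (EuclideanSpace.single j 1)

end ChainSeq

/-- Norm-like functions: `V(x) → ∞` as `|x| → ∞`. -/
def NormLike {d : ℕ} (V : Euc d → ℝ) : Prop :=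
  Filter.Tendsto V (Bornology.cobounded (Euc d)) Filter.atTop

/-- Sub-exponential functions. The norms of the gradient and of the Hessian are the operator norms of
the first and second derivatives. -/
structure SubExponential {d : ℕ} (V : Euc d → ℝ) : Prop where
  contDiff : ContDiff ℝ 2 V
  one_le : ∀ x, 1 ≤ V x
  deriv_bound : ∃ c₁ c₂ : ℝ, ∀ x,
    max ‖fderiv ℝ V x‖ ‖fderiv ℝ (fderiv ℝ V) x‖ ≤ c₁ * Real.exp (c₂ * ‖x‖)
  ratio_bound : ∃ c₃ : ℝ, ∀ x y, ‖y‖ ≤ 1 → V (x + y) / V x ≤ c₃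

/-- The Lipschitz seminorm `[Ψ]_{2,1,B}` of the Hessian of `Ψ` on `B`, possibly infinite
(here `0 / 0 = 0`). -/
noncomputable def hessianLip {d : ℕ} (Ψ : Euc d → ℝ) (B : Set (Euc d)) : ℝ≥0∞ :=
  ⨆ y ∈ B, ⨆ z ∈ B, ‖fderiv ℝ (fderiv ℝ Ψ) y - fderiv ℝ (fderiv ℝ Ψ) z‖ₑ / ‖y - z‖ₑ

namespace ChainSeq

open MeasureTheory

variable {d : ℕ}

/-- The uniform Lyapunov assumption on `V`. By Tonelli's theorem, the last condition is
`E_x[∫_0^t ((1 + |X(s)|)^4 V(X(s)))² ds] < ∞` for the centered and scaled chain `X`. -/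
structure Lyapunov (M : ChainSeq d) (V : Euc d → ℝ) : Prop where
  subExponential : SubExponential V
  normLike : NormLike V
  drift : ∃ b δ K : ℝ, 0 < b ∧ 0 < δ ∧ 0 < K ∧ ∀ n, M.Index n → ∀ x,
    M.gen n V x ≤ -δ * V x + (Metric.closedBall (0 : Euc d) K).indicator (fun _ => b) x
  integrable : ∀ n, M.Index n → ∀ (x : M.E n) (t : ℝ), 0 ≤ t →
    ∫⁻ s in Set.Icc (0 : ℝ) t,
      ∫⁻ u, ENNReal.ofReal (((1 + ‖u‖) ^ 4 * V u) ^ 2) ∂(M.law n s x) < ∞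

/-- The derivative condition on `V`: the gradient, the Hessian and the local Lipschitz constant of the
Hessian, times `1 + |x|`, are bounded by a multiple of `V`. -/
def DerivCondition (M : ChainSeq d) (V : Euc d → ℝ) : Prop :=
  ∃ C : ℝ, 0 < C ∧ ∀ n, M.Index n → ∀ x,
    (‖fderiv ℝ V x‖ₑ + ‖fderiv ℝ (fderiv ℝ V) x‖ₑ +
      hessianLip V (Metric.ball x (M.jumpBound / √(n : ℝ)))) * ENNReal.ofReal (1 + ‖x‖)
        ≤ ENNReal.ofReal (C * V x)

end ChainSeq

/-! Along the scaled chain, `Vbar` is a Foster–Lyapunov function with constants independent of large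
$n$. A second-order Taylor expansion over one jump reproduces the diffusion generator plus two
errors: freezing $\bar a^n$ at $0$ costs $O(|x|/\sqrt n)\,|D^2\bar V|$, and the remainder costs the
local Lipschitz constant of the Hessian times $\bar\ell/\sqrt n$ times the trace of $\bar a^n(x)$,
which grows at most linearly. The weight $1+|x|$ in the derivative condition absorbs this growth, so
both errors are $O(1/\sqrt n)\bar V$ (`exists_chain_generator_le`). For large $n$ they use up at
most half of the decay rate $\delta$.

The resulting drift inequality gives $E_x[\bar V(\widehat X^n(t))]\le e^{-\delta t/2}\bar
V(x)+(2b/\delta)(1-e^{-\delta t/2})$. This is proved by induction on the number of jumps, through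
the first-jump recursion (`tsum_transIter_mul_le`). Letting $t\to\infty$ on truncations of $\bar V$
bounds $\nu^n(\bar V)$ by $2b/\delta$ (`IsSteadyState.lintegral_le`); the claim for $V$ follows by
domination. -/

namespace CTMC

/-! ### Foster–Lyapunov bounds for the minimal transition function. -/

variable {S : Type*}

theorem transIter_le_succ (q : S → S → ℝ≥0) (k : ℕ) :
    ∀ (t : ℝ) (x y : S), transIter q k t x y ≤ transIter q (k + 1) t x y := by
  induction k with
  | zero => intro t x y; simp [transIter]
  | succ k ih =>
    intro t x y
    rw [transIter, transIter]
    refine add_le_add le_rfl (MeasureTheory.lintegral_mono fun s => ?_)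
    exact mul_le_mul_right (ENNReal.tsum_le_tsum fun z => mul_le_mul_right (ih _ _ _) _) _

theorem transIter_monotone (q : S → S → ℝ≥0) (t : ℝ) (x y : S) :
    Monotone fun k => transIter q k t x y :=
  monotone_nat_of_le_succ fun k => transIter_le_succ q k t x y

/-- Superadditivity of the lower Lebesgue integral; no measurability is needed. -/
theorem tsum_lintegral_le {α ι : Type*} [MeasurableSpace α] (μ : MeasureTheory.Measure α)
    (f : ι → α → ℝ≥0∞) : ∑' i, ∫⁻ a, f i a ∂μ ≤ ∫⁻ a, ∑' i, f i a ∂μ := by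
  classical
  have key : ∀ s : Finset ι, ∑ i ∈ s, ∫⁻ a, f i a ∂μ ≤ ∫⁻ a, ∑ i ∈ s, f i a ∂μ := by
    intro s
    induction s using Finset.induction_on with
    | empty => simp
    | insert i s hi ih =>
      simp only [Finset.sum_insert hi]
      exact (add_le_add le_rfl ih).trans (MeasureTheory.le_lintegral_add _ _)
  rw [ENNReal.tsum_eq_iSup_sum]
  exact iSup_le fun s => (key s).trans
    (MeasureTheory.lintegral_mono fun a => ENNReal.sum_le_tsum s)

/-- With $g(s)=e^{-\delta(t-s)}w+c(1-e^{-\delta(t-s)})$, the integrand is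
$-\frac{d}{ds}\big(e^{-ls}g(s)\big)$. This is the identity that makes the claimed moment bound
reproduce itself under conditioning on the first jump, at rate $l$. -/
theorem integral_exp_supersolution (l δ c w t : ℝ) (ht : 0 ≤ t) :
    ∫ s in Set.Icc (0 : ℝ) t, Real.exp (-(l * s)) *
        (Real.exp (-(δ * (t - s))) * ((l - δ) * w + δ * c)
          + l * (c * (1 - Real.exp (-(δ * (t - s))))))
      = Real.exp (-(δ * t)) * w + c * (1 - Real.exp (-(δ * t))) - Real.exp (-(l * t)) * w := by
  rw [MeasureTheory.integral_Icc_eq_integral_Ioc, ← intervalIntegral.integral_of_le ht]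
  rw [intervalIntegral.integral_eq_sub_of_hasDerivAt
    (f := fun s => -(Real.exp (-(l * s)) *
      (Real.exp (-(δ * (t - s))) * w + c * (1 - Real.exp (-(δ * (t - s)))))))]
  · simp; ring
  · intro s _
    have h1 : HasDerivAt (fun s : ℝ => Real.exp (-(l * s))) (Real.exp (-(l * s)) * (-l)) s := by
      apply HasDerivAt.exp
      exact (((hasDerivAt_id s).const_mul l).neg).congr_deriv (by simp)
    have h2 : HasDerivAt (fun s : ℝ => Real.exp (-(δ * (t - s))))
        (Real.exp (-(δ * (t - s))) * δ) s := by
      apply HasDerivAt.exp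
      exact ((((hasDerivAt_id s).const_sub t).const_mul δ).neg).congr_deriv (by simp)
    have h3 := (h1.mul ((h2.mul_const w).add ((h2.const_sub 1).const_mul c))).neg
    refine HasDerivAt.congr_deriv h3 ?_
    simp only [Pi.add_apply]
    ring
  · exact Continuous.intervalIntegrable (by fun_prop) _ _

theorem exp_supersolution_integrand_nonneg {l δ c w t s : ℝ} (hs : s ≤ t) (hδ : 0 < δ)
    (hc : 0 ≤ c) (hl : 0 ≤ l) (h : 0 ≤ (l - δ) * w + δ * c) :
    0 ≤ Real.exp (-(l * s)) * (Real.exp (-(δ * (t - s))) * ((l - δ) * w + δ * c)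
          + l * (c * (1 - Real.exp (-(δ * (t - s)))))) := by
  have : Real.exp (-(δ * (t - s))) ≤ 1 := by
    rw [Real.exp_le_one_iff]; nlinarith
  have : 0 ≤ 1 - Real.exp (-(δ * (t - s))) := by linarith
  positivity

theorem exp_supersolution_nonneg (l δ c w t : ℝ) (ht : 0 ≤ t) (hδ : 0 < δ) (hc : 0 ≤ c)
    (hl : 0 ≤ l) (h : 0 ≤ (l - δ) * w + δ * c) :
    0 ≤ Real.exp (-(δ * t)) * w + c * (1 - Real.exp (-(δ * t))) - Real.exp (-(l * t)) * w := by
  rw [← integral_exp_supersolution l δ c w t ht]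
  exact MeasureTheory.setIntegral_nonneg measurableSet_Icc fun s hs =>
    exp_supersolution_integrand_nonneg hs.2 hδ hc hl h

theorem lintegral_exp_supersolution (l δ c w t : ℝ) (ht : 0 ≤ t) (hδ : 0 < δ) (hc : 0 ≤ c)
    (hl : 0 ≤ l) (h : 0 ≤ (l - δ) * w + δ * c) :
    ∫⁻ s in Set.Icc (0 : ℝ) t, ENNReal.ofReal (Real.exp (-(l * s)) *
        (Real.exp (-(δ * (t - s))) * ((l - δ) * w + δ * c)
          + l * (c * (1 - Real.exp (-(δ * (t - s)))))))
      = ENNReal.ofReal (Real.exp (-(δ * t)) * w + c * (1 - Real.exp (-(δ * t)))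
          - Real.exp (-(l * t)) * w) := by
  rw [← MeasureTheory.ofReal_integral_eq_lintegral_ofReal, integral_exp_supersolution _ _ _ _ _ ht]
  · exact (Continuous.continuousOn (by fun_prop)).integrableOn_Icc
  · exact (MeasureTheory.ae_restrict_iff' measurableSet_Icc).2 (.of_forall fun s hs =>
      exp_supersolution_integrand_nonneg hs.2 hδ hc hl h)

variable {q : S → S → ℝ≥0} {W : S → ℝ} {δ c : ℝ}

/-- The Foster–Lyapunov bound for the chain stopped after finitely many jumps. -/
theorem tsum_transIter_mul_le (hq : ∀ x, exitRate q x < ∞) (hW : ∀ x, 0 ≤ W x)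
    (hδ : 0 < δ) (hc : 0 ≤ c)
    (hnonneg : ∀ x, 0 ≤ ((exitRate q x).toReal - δ) * W x + δ * c)
    (hdrift : ∀ x, ∑' z, offDiag q x z * ENNReal.ofReal (W z) ≤
      ENNReal.ofReal (((exitRate q x).toReal - δ) * W x + δ * c)) (k : ℕ) :
    ∀ t : ℝ, 0 ≤ t → ∀ x, ∑' y, transIter q k t x y * ENNReal.ofReal (W y) ≤
      ENNReal.ofReal (Real.exp (-(δ * t)) * W x + c * (1 - Real.exp (-(δ * t)))) := by
  classical
  induction k with
  | zero => intro t _ x; simp [transIter]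
  | succ k ih =>
    intro t ht x
    set l := (exitRate q x).toReal with hl
    have hl0 : 0 ≤ l := ENNReal.toReal_nonneg
    have hlq : ENNReal.ofReal l = exitRate q x := ENNReal.ofReal_toReal (hq x).ne
    -- The induction hypothesis is affine in `W z`, so summing it over the target of the first jump
    -- needs only the total rate and the drift condition.
    have hstep : ∀ s ∈ Set.Icc (0 : ℝ) t,
        ∑' y, ENNReal.ofReal (W y) * (ENNReal.ofReal (Real.exp (-(l * s))) *
            ∑' z, offDiag q x z * transIter q k (t - s) z y) ≤
          ENNReal.ofReal (Real.exp (-(l * s)) *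
            (Real.exp (-(δ * (t - s))) * ((l - δ) * W x + δ * c)
              + l * (c * (1 - Real.exp (-(δ * (t - s))))))) := by
      intro s hs
      have hts : 0 ≤ t - s := by linarith [hs.2]
      have he1 : Real.exp (-(δ * (t - s))) ≤ 1 := by
        rw [Real.exp_le_one_iff]; nlinarith
      have he2 : 0 ≤ c * (1 - Real.exp (-(δ * (t - s)))) :=
        mul_nonneg hc (by linarith)
      have he3 := (Real.exp_pos (-(δ * (t - s)))).le
      calc _ = ENNReal.ofReal (Real.exp (-(l * s))) * ∑' z, offDiag q x z *
            ∑' y, transIter q k (t - s) z y * ENNReal.ofReal (W y) := by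
              simp_rw [← ENNReal.tsum_mul_left]
              rw [ENNReal.tsum_comm]
              refine tsum_congr fun z => tsum_congr fun y => ?_
              ring
        _ ≤ ENNReal.ofReal (Real.exp (-(l * s))) * ∑' z, offDiag q x z *
            ENNReal.ofReal (Real.exp (-(δ * (t - s))) * W z +
              c * (1 - Real.exp (-(δ * (t - s))))) := by
              gcongr with z
              exact ih _ hts z
        _ = ENNReal.ofReal (Real.exp (-(l * s))) *
            (ENNReal.ofReal (Real.exp (-(δ * (t - s)))) *
                ∑' z, offDiag q x z * ENNReal.ofReal (W z) +
              exitRate q x * ENNReal.ofReal (c * (1 - Real.exp (-(δ * (t - s)))))) := by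
              congr 1
              rw [exitRate, ← ENNReal.tsum_mul_left, ← ENNReal.tsum_mul_right, ← ENNReal.tsum_add]
              refine tsum_congr fun z => ?_
              rw [ENNReal.ofReal_add (mul_nonneg he3 (hW z)) he2, ENNReal.ofReal_mul he3]
              ring
        _ ≤ _ := by
              rw [ENNReal.ofReal_mul (Real.exp_pos _).le,
                ENNReal.ofReal_add (mul_nonneg he3 (hnonneg x)) (mul_nonneg hl0 he2),
                ENNReal.ofReal_mul he3, ENNReal.ofReal_mul hl0, hlq]
              gcongr
              exact hdrift x
    have hint : ∑' y, ENNReal.ofReal (W y) * ∫⁻ s in Set.Icc (0 : ℝ) t,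
          ENNReal.ofReal (Real.exp (-(l * s))) *
            ∑' z, offDiag q x z * transIter q k (t - s) z y ≤
        ENNReal.ofReal (Real.exp (-(δ * t)) * W x + c * (1 - Real.exp (-(δ * t)))
          - Real.exp (-(l * t)) * W x) := by
      rw [← lintegral_exp_supersolution l δ c (W x) t ht hδ hc hl0 (hnonneg x)]
      calc _ ≤ ∑' y, ∫⁻ s in Set.Icc (0 : ℝ) t, ENNReal.ofReal (W y) *
            (ENNReal.ofReal (Real.exp (-(l * s))) *
              ∑' z, offDiag q x z * transIter q k (t - s) z y) :=
            ENNReal.tsum_le_tsum fun y => MeasureTheory.lintegral_const_mul_le _ _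
        _ ≤ _ := tsum_lintegral_le _ _
        _ ≤ _ := MeasureTheory.setLIntegral_mono' measurableSet_Icc hstep
    -- The first term is the event of no jump before $t$; it cancels the term subtracted in `hint`.
    have hsplit : ∑' y, transIter q (k + 1) t x y * ENNReal.ofReal (W y) =
        ENNReal.ofReal (Real.exp (-(l * t)) * W x) +
        ∑' y, ENNReal.ofReal (W y) * ∫⁻ s in Set.Icc (0 : ℝ) t,
          ENNReal.ofReal (Real.exp (-(l * s))) *
            ∑' z, offDiag q x z * transIter q k (t - s) z y := by
      have h1 : ENNReal.ofReal (Real.exp (-(l * t)) * W x) =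
          ∑' y, (if x = y then ENNReal.ofReal (Real.exp (-(l * t))) else 0) *
            ENNReal.ofReal (W y) := by
        rw [tsum_eq_single x]
        · simp [ENNReal.ofReal_mul (Real.exp_pos _).le]
        · intro y hy; simp [hy.symm]
      rw [h1, ← ENNReal.tsum_add]
      refine tsum_congr fun y => ?_
      rw [transIter, add_mul, mul_comm (ENNReal.ofReal (W y))]
    rw [hsplit]
    have hpos := exp_supersolution_nonneg l δ c (W x) t ht hδ hc hl0 (hnonneg x)
    calc _ ≤ ENNReal.ofReal (Real.exp (-(l * t)) * W x) + _ := add_le_add le_rfl hint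
      _ = _ := by
        rw [← ENNReal.ofReal_add (mul_nonneg (Real.exp_pos _).le (hW x)) hpos]
        congr 1; ring

/-- The bound for `transIter` is uniform in `k`, and monotonicity in `k` lets the supremum pass
through finite sums. -/
theorem tsum_trans_mul_le (hq : ∀ x, exitRate q x < ∞) (hW : ∀ x, 0 ≤ W x)
    (hδ : 0 < δ) (hc : 0 ≤ c)
    (hnonneg : ∀ x, 0 ≤ ((exitRate q x).toReal - δ) * W x + δ * c)
    (hdrift : ∀ x, ∑' z, offDiag q x z * ENNReal.ofReal (W z) ≤
      ENNReal.ofReal (((exitRate q x).toReal - δ) * W x + δ * c)) {t : ℝ} (ht : 0 ≤ t) (x : S) :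
    ∑' y, trans q t x y * ENNReal.ofReal (W y) ≤
      ENNReal.ofReal (Real.exp (-(δ * t)) * W x + c * (1 - Real.exp (-(δ * t)))) := by
  rw [ENNReal.tsum_eq_iSup_sum]
  refine iSup_le fun s => ?_
  simp only [trans, ENNReal.iSup_mul]
  rw [ENNReal.finsetSum_iSup_of_monotone (f := fun y k => transIter q k t x y * ENNReal.ofReal (W y))
    fun y _ _ h => mul_le_mul_left (transIter_monotone q t x y h) _]
  exact iSup_le fun k => (ENNReal.sum_le_tsum s).trans
    (tsum_transIter_mul_le hq hW hδ hc hnonneg hdrift k t ht x)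

end CTMC

/-! ### Taylor expansion with a Hessian of controlled oscillation. -/

section Taylor

variable {X : Type*} [NormedAddCommGroup X] [NormedSpace ℝ X]

/-- Second-order Taylor estimate under a bound on the oscillation of the second derivative. -/
theorem abs_taylor_two_le {f : X → ℝ} (hf : ContDiff ℝ 2 f) (x h : X) {κ : ℝ}
    (hκ : ∀ y ∈ Metric.closedBall x ‖h‖, ‖fderiv ℝ (fderiv ℝ f) y - fderiv ℝ (fderiv ℝ f) x‖ ≤ κ) :
    |f (x + h) - f x - fderiv ℝ f x h - 1 / 2 * fderiv ℝ (fderiv ℝ f) x h h| ≤ κ * ‖h‖ ^ 2 := by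
  have hf1 : Differentiable ℝ f := hf.differentiable (by norm_num)
  have hf2 : Differentiable ℝ (fderiv ℝ f) :=
    (hf.fderiv_right (m := 1) (by norm_num)).differentiable (by norm_num)
  have hκ0 : 0 ≤ κ := (norm_nonneg (fderiv ℝ (fderiv ℝ f) x - fderiv ℝ (fderiv ℝ f) x)).trans
    (hκ x (by simp))
  have hgrad : ∀ y ∈ Metric.closedBall x ‖h‖,
      ‖fderiv ℝ f y - fderiv ℝ f x - fderiv ℝ (fderiv ℝ f) x (y - x)‖ ≤ κ * ‖h‖ := by
    intro y hy
    have := (convex_closedBall x ‖h‖).norm_image_sub_le_of_norm_hasFDerivWithin_le'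
      (f := fderiv ℝ f) (fun z _ => (hf2 z).hasFDerivAt.hasFDerivWithinAt) hκ
      (Metric.mem_closedBall_self (norm_nonneg h)) hy
    refine this.trans ?_
    gcongr
    simpa [dist_eq_norm] using hy
  -- Along the segment, the quadratic Taylor polynomial is subtracted, so the derivative is the
  -- gradient remainder `hgrad` applied to `h`. A second mean value inequality then suffices.
  have hline : ∀ s ∈ Set.Icc (0 : ℝ) 1, HasDerivWithinAt
      (fun s : ℝ => f (x + s • h) - s * fderiv ℝ f x h
        - s ^ 2 / 2 * fderiv ℝ (fderiv ℝ f) x h h)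
      (fderiv ℝ f (x + s • h) h - fderiv ℝ f x h - s * fderiv ℝ (fderiv ℝ f) x h h)
      (Set.Icc 0 1) s := by
    intro s _
    have h1 : HasDerivAt (fun s : ℝ => x + s • h) h s := by
      simpa using ((hasDerivAt_id s).smul_const h).const_add x
    have h2 := (hf1 (x + s • h)).hasFDerivAt.comp_hasDerivAt s h1
    have h3 := (hasDerivAt_id s).mul_const (fderiv ℝ f x h)
    have h4 := (((hasDerivAt_id s).pow 2).div_const 2).mul_const (fderiv ℝ (fderiv ℝ f) x h h)
    refine (((h2.sub h3).sub h4).congr_deriv ?_).hasDerivWithinAt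
    simp
  have := (convex_Icc (0 : ℝ) 1).norm_image_sub_le_of_norm_hasDerivWithin_le (C := κ * ‖h‖ * ‖h‖)
    hline (fun s hs => ?_) (Set.left_mem_Icc.2 zero_le_one) (Set.right_mem_Icc.2 zero_le_one)
  · simp only [Real.norm_eq_abs, one_smul, zero_smul, add_zero, sub_zero, abs_one, mul_one] at this
    convert this using 1
    · congr 1; ring
    · ring
  · have hy : x + s • h ∈ Metric.closedBall x ‖h‖ := by
      simp only [Metric.mem_closedBall, dist_self_add_left, norm_smul, Real.norm_eq_abs,
        abs_of_nonneg hs.1]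
      exact mul_le_of_le_one_left (norm_nonneg _) hs.2
    have h5 := (fderiv ℝ f (x + s • h) - fderiv ℝ f x
      - fderiv ℝ (fderiv ℝ f) x (x + s • h - x)).le_of_opNorm_le (hgrad _ hy) h
    simpa using h5

/-- The seminorm lives on an open ball, but jumps of maximal size land on its boundary sphere;
continuity of the Hessian extends the estimate to the closure. -/
theorem norm_hessian_sub_le_of_ball {f : X → ℝ} (hf : ContDiff ℝ 2 f) {x : X} {r L : ℝ}
    (hr : 0 < r) (hL : ∀ y ∈ Metric.ball x r, y ≠ x →
      ‖fderiv ℝ (fderiv ℝ f) y - fderiv ℝ (fderiv ℝ f) x‖ ≤ L * ‖y - x‖) {y : X}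
    (hy : y ∈ Metric.closedBall x r) :
    ‖fderiv ℝ (fderiv ℝ f) y - fderiv ℝ (fderiv ℝ f) x‖ ≤ L * ‖y - x‖ := by
  have hcont : Continuous (fderiv ℝ (fderiv ℝ f)) :=
    (hf.fderiv_right (m := 1) (by norm_num)).continuous_fderiv (by norm_num)
  have hclosed : IsClosed {y | ‖fderiv ℝ (fderiv ℝ f) y - fderiv ℝ (fderiv ℝ f) x‖ ≤
      L * ‖y - x‖} :=
    isClosed_le (Continuous.norm (E := X →L[ℝ] X →L[ℝ] ℝ) (hcont.sub continuous_const))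
      (by fun_prop)
  rw [← closure_ball x hr.ne'] at hy
  refine closure_minimal (fun z hz => ?_) hclosed hy
  rcases eq_or_ne z x with rfl | hzx
  · rw [Set.mem_ofPred_eq, sub_self, sub_self, norm_zero (E := X), mul_zero]
    exact ContinuousLinearMap.opNorm_zero.le
  · exact hL z hz hzx

theorem abs_bilin_apply_le (B : X →L[ℝ] X →L[ℝ] ℝ) {u v : X} (hu : ‖u‖ ≤ 1) (hv : ‖v‖ ≤ 1) :
    |B u v| ≤ ‖B‖ := by
  have h := B.le_opNorm₂ u v
  rw [Real.norm_eq_abs, mul_assoc] at h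
  exact h.trans (mul_le_of_le_one_right (norm_nonneg B) (mul_le_one₀ hu (norm_nonneg _) hv))

end Taylor

theorem norm_hessian_sub_le_of_hessianLip_ne_top {d : ℕ} {f : Euc d → ℝ} (hf : ContDiff ℝ 2 f)
    {x : Euc d} {r : ℝ} (hr : 0 < r) (htop : hessianLip f (Metric.ball x r) ≠ ∞) {y : Euc d}
    (hy : y ∈ Metric.closedBall x r) :
    ‖fderiv ℝ (fderiv ℝ f) y - fderiv ℝ (fderiv ℝ f) x‖ ≤
      (hessianLip f (Metric.ball x r)).toReal * ‖y - x‖ := by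
  refine norm_hessian_sub_le_of_ball hf hr (fun z hz hzx => ?_) hy
  have hne : ‖z - x‖ₑ ≠ 0 := by simpa [sub_eq_zero] using hzx
  have h1 : ‖fderiv ℝ (fderiv ℝ f) z - fderiv ℝ (fderiv ℝ f) x‖ₑ / ‖z - x‖ₑ ≤
      hessianLip f (Metric.ball x r) :=
    le_iSup₂_of_le z hz (le_iSup₂_of_le x (Metric.mem_ball_self hr) le_rfl)
  rw [ENNReal.div_le_iff hne enorm_ne_top] at h1
  have h2 := ENNReal.toReal_mono (ENNReal.mul_ne_top htop enorm_ne_top) h1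
  rw [ENNReal.toReal_mul, toReal_enorm] at h2
  exact h2

theorem EuclideanSpace.eq_sum_single {d : ℕ} (h : Euc d) :
    h = ∑ i, h i • EuclideanSpace.single i (1 : ℝ) := by
  ext j
  simp [Finset.sum_apply, Pi.single_apply]

theorem fderiv_apply_eq_sum {d : ℕ} (L : Euc d →L[ℝ] ℝ) (h : Euc d) :
    L h = ∑ i, h i * L (EuclideanSpace.single i 1) := by
  conv_lhs => rw [EuclideanSpace.eq_sum_single h]
  simp

theorem bilin_apply_eq_sum {d : ℕ} (B : Euc d →L[ℝ] Euc d →L[ℝ] ℝ) (h : Euc d) :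
    B h h = ∑ i, ∑ j, h i * h j *
      B (EuclideanSpace.single i 1) (EuclideanSpace.single j 1) := by
  conv_lhs => rw [EuclideanSpace.eq_sum_single h]
  simp [Finset.mul_sum, mul_assoc]
  rw [Finset.sum_comm]
  refine Finset.sum_congr rfl fun i _ => Finset.sum_congr rfl fun j _ => ?_
  ring

/-- Compensated sums of a function against a weighted family of displacements. -/
theorem summable_and_tsum_le_of_taylor {S : Type*} {d : ℕ} {f : Euc d → ℝ} (hf0 : ∀ x, 0 ≤ f x)
    (x : Euc d) {b : S → ℝ} (hb : ∀ y, 0 ≤ b y) (h : S → Euc d) {l κ : ℝ} {μ : Euc d}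
    {A : Matrix (Fin d) (Fin d) ℝ} (hl : HasSum b l) (hμ : HasSum (fun y => b y • h y) μ)
    (hA : ∀ i j, HasSum (fun y => b y * (h y i * h y j)) (A i j))
    (htaylor : ∀ y, b y ≠ 0 → f (x + h y) ≤ f x + fderiv ℝ f x (h y) +
      1 / 2 * fderiv ℝ (fderiv ℝ f) x (h y) (h y) + κ * ‖h y‖ ^ 2) :
    Summable (fun y => b y * f (x + h y)) ∧
      ∑' y, b y * f (x + h y) ≤ l * f x + ∑ i, μ i * fderiv ℝ f x (EuclideanSpace.single i 1) +
        1 / 2 * ∑ i, ∑ j, A i j *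
          fderiv ℝ (fderiv ℝ f) x (EuclideanSpace.single i 1) (EuclideanSpace.single j 1) +
        κ * ∑ i, A i i := by
  set D := fderiv ℝ f x
  set H := fderiv ℝ (fderiv ℝ f) x
  have h1 : HasSum (fun y => b y * f x) (l * f x) := hl.mul_right _
  have h2 : HasSum (fun y => b y * D (h y)) (D μ) := by
    simpa using hμ.mapL D
  have h3 : HasSum (fun y => b y * H (h y) (h y)) (∑ i, ∑ j, A i j *
      H (EuclideanSpace.single i 1) (EuclideanSpace.single j 1)) := by
    have := hasSum_sum (s := Finset.univ) fun i _ => hasSum_sum (s := Finset.univ) fun j _ =>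
      (hA i j).mul_right (H (EuclideanSpace.single i 1) (EuclideanSpace.single j 1))
    refine this.congr_fun fun y => ?_
    rw [bilin_apply_eq_sum, Finset.mul_sum]
    refine Finset.sum_congr rfl fun i _ => ?_
    rw [Finset.mul_sum]
    exact Finset.sum_congr rfl fun j _ => by ring
  -- The trace of `A` is the total weight of the squared displacements, hence of the Taylor
  -- remainders.
  have h4 : HasSum (fun y => b y * ‖h y‖ ^ 2) (∑ i, A i i) := by
    have := hasSum_sum (s := Finset.univ) fun i _ => hA i i
    refine this.congr_fun fun y => ?_
    rw [EuclideanSpace.real_norm_sq_eq, Finset.mul_sum]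
    exact Finset.sum_congr rfl fun j _ => by ring
  have htot := ((h1.add h2).add (h3.mul_left (1 / 2))).add (h4.mul_left κ)
  rw [fderiv_apply_eq_sum D μ] at htot
  have hle : ∀ y, b y * f (x + h y) ≤
      b y * f x + b y * D (h y) + 1 / 2 * (b y * H (h y) (h y)) + κ * (b y * ‖h y‖ ^ 2) := by
    intro y
    rcases eq_or_ne (b y) 0 with h0 | h0
    · simp [h0]
    · have := mul_le_mul_of_nonneg_left (htaylor y h0) (hb y)
      linarith
  have hsum : Summable (fun y => b y * f (x + h y)) :=
    .of_nonneg_of_le (fun y => mul_nonneg (hb y) (hf0 _)) hle htot.summable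
  exact ⟨hsum, hasSum_le hle hsum.hasSum htot⟩

/-! ### Generator of the scaled chain against that of the diffusion. -/

namespace ChainSeq

open MeasureTheory

variable {d : ℕ}

theorem jumpBound_nonneg (M : ChainSeq d) : 0 ≤ M.jumpBound := by
  refine Real.sSup_nonneg ?_
  rintro r ⟨n, -, x, y, -, -, rfl⟩
  exact norm_nonneg _

theorem xbar_add_scale (M : ChainSeq d) {n : ℕ} (hn : 1 ≤ n) (x : Euc d) :
    M.xbar n + √(n : ℝ) • M.scale n x = x := by
  have : √(n : ℝ) ≠ 0 := by positivity
  rw [scale, smul_inv_smul₀ this]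
  abel

theorem scale_add_smul_sub (M : ChainSeq d) (n : ℕ) (x y : Euc d) :
    M.scale n x + (√(n : ℝ))⁻¹ • (y - x) = M.scale n y := by
  simp only [scale, ← smul_add]
  congr 1
  abel

theorem norm_scaled_jump_le (M : ChainSeq d) (hM : M.Base) {n : ℕ} (hn : 1 ≤ n) {x y : M.E n}
    (h : (CTMC.offDiag (M.rate n) x y).toReal ≠ 0) :
    (y : Euc d) ≠ x ∧ ‖(√(n : ℝ))⁻¹ • ((y : Euc d) - x)‖ ≤ M.jumpBound / √(n : ℝ) := by
  have hyx : y ≠ x := by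
    rintro rfl; simp [CTMC.offDiag] at h
  have hpos : 0 < M.rate n x y := by
    rw [pos_iff_ne_zero]; intro h0; simp [CTMC.offDiag, h0] at h
  refine ⟨fun h' => hyx (Subtype.ext h'), ?_⟩
  rw [norm_smul, norm_inv, Real.norm_eq_abs, abs_of_nonneg (Real.sqrt_nonneg _), div_eq_inv_mul]
  gcongr
  exact le_csSup hM.boundedJumps ⟨n, hn, x, y, hyx, hpos, rfl⟩

/-- Diagonal rates are arbitrary, but they do not matter for quantities that vanish at zero
displacement. -/
theorem offDiag_smul_sub (M : ChainSeq d) {n : ℕ} (x y : M.E n) {R : Type*} [Zero R]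
    [SMulWithZero ℝ R] (g : R) (hg : y = x → g = 0) :
    (CTMC.offDiag (M.rate n) x y).toReal • g = (M.rate n x y : ℝ) • g := by
  by_cases h : y = x
  · simp [hg h]
  · simp [CTMC.offDiag, h]

theorem hasSum_offDiag (M : ChainSeq d) (hM : M.Base) {n : ℕ} (hn : M.Index n) (x : M.E n) :
    HasSum (fun y => (CTMC.offDiag (M.rate n) x y).toReal)
      (CTMC.exitRate (M.rate n) x).toReal := by
  have hne := (hM.exitRate_lt_top n hn x).ne
  rw [CTMC.exitRate, ENNReal.tsum_toReal_eq (ENNReal.ne_top_of_tsum_ne_top hne)]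
  exact ENNReal.hasSum_toReal hne

theorem hasSum_scaled_drift (M : ChainSeq d) (hM : M.Base) {n : ℕ} (hn : M.Index n) (x : M.E n) :
    HasSum (fun y : M.E n => (CTMC.offDiag (M.rate n) x y).toReal •
      ((√(n : ℝ))⁻¹ • ((y : Euc d) - x))) (M.Fhat n (M.scale n x)) := by
  rw [Fhat, xbar_add_scale M hn.1]
  refine ((hM.drift n hn x).const_smul (√(n : ℝ))⁻¹).congr_fun fun y => ?_
  rw [offDiag_smul_sub M x y _ (by rintro rfl; simp), smul_comm]

theorem hasSum_scaled_quadVar (M : ChainSeq d) (hM : M.Base) {n : ℕ} (hn : M.Index n)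
    (x : M.E n) (i j : Fin d) :
    HasSum (fun y : M.E n => (CTMC.offDiag (M.rate n) x y).toReal *
      (((√(n : ℝ))⁻¹ • ((y : Euc d) - x)) i * ((√(n : ℝ))⁻¹ • ((y : Euc d) - x)) j))
      (M.abar n (M.scale n x) i j) := by
  rw [abar, xbar_add_scale M hn.1, Matrix.smul_apply, smul_eq_mul]
  refine ((hM.quadVar n hn x i j).mul_left (n : ℝ)⁻¹).congr_fun fun y => ?_
  have h := offDiag_smul_sub M x y
    (((√(n : ℝ))⁻¹ • ((y : Euc d) - x)) i * ((√(n : ℝ))⁻¹ • ((y : Euc d) - x)) j)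
    (by rintro rfl; simp)
  rw [smul_eq_mul, smul_eq_mul] at h
  have hs : (√(n : ℝ))⁻¹ * (√(n : ℝ))⁻¹ = (n : ℝ)⁻¹ := by
    rw [← mul_inv, Real.mul_self_sqrt (Nat.cast_nonneg n)]
  rw [h, ← hs]
  simp only [PiLp.smul_apply, PiLp.sub_apply, smul_eq_mul]
  ring

open scoped Matrix.Norms.Frobenius in
theorem _root_.Matrix.abs_apply_le_frobenius_norm (A : Matrix (Fin d) (Fin d) ℝ) (i j : Fin d) :
    |A i j| ≤ ‖A‖ := by
  rw [Matrix.frobenius_norm_def, ← Real.sqrt_eq_rpow]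
  refine Real.le_sqrt_of_sq_le ?_
  rw [← Real.norm_eq_abs]
  have h1 : ‖A i j‖ ^ (2 : ℝ) ≤ ∑ j, ‖A i j‖ ^ (2 : ℝ) :=
    Finset.single_le_sum (f := fun j => ‖A i j‖ ^ (2 : ℝ)) (fun _ _ => by positivity)
      (Finset.mem_univ j)
  have h2 : ∑ j, ‖A i j‖ ^ (2 : ℝ) ≤ ∑ i, ∑ j, ‖A i j‖ ^ (2 : ℝ) :=
    Finset.single_le_sum (f := fun i => ∑ j, ‖A i j‖ ^ (2 : ℝ)) (fun _ _ => by positivity)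
      (Finset.mem_univ i)
  simpa using h1.trans h2

theorem Base.exists_abar_sub_le {M : ChainSeq d} (hM : M.Base) : ∃ Ka : ℝ, 0 ≤ Ka ∧
    ∀ n, M.Index n → ∀ x i j,
      |M.abar n x i j - M.abar n 0 i j| ≤ Ka / √(n : ℝ) * ‖x‖ := by
  obtain ⟨Ka, h⟩ := hM.linearGrowth
  refine ⟨|Ka|, abs_nonneg _, fun n hn x i j => ?_⟩
  have h1 := Matrix.abs_apply_le_frobenius_norm (M.abar n x - M.abar n 0) i j
  rw [Matrix.sub_apply] at h1
  refine (h1.trans (h n hn x)).trans ?_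
  gcongr
  exact le_abs_self _

open scoped Matrix.Norms.Frobenius in
theorem Base.exists_abar_zero_le {M : ChainSeq d} (hM : M.Base) : ∃ T : ℝ, 0 ≤ T ∧
    ∀ᶠ n in Filter.atTop, ∀ i j, |M.abar n 0 i j| ≤ T := by
  obtain ⟨A, -, h⟩ := hM.limit
  refine ⟨‖A‖ + 1, by positivity, ?_⟩
  filter_upwards [h.norm.eventually (eventually_le_nhds (lt_add_one ‖A‖))] with n hn i j
  exact (Matrix.abs_apply_le_frobenius_norm _ i j).trans hn

theorem DerivCondition.exists_bounds {M : ChainSeq d} {V : Euc d → ℝ} (h : M.DerivCondition V)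
    (hV : ∀ x, 0 ≤ V x) :
    ∃ C : ℝ, 0 < C ∧ ∀ n, M.Index n → ∀ x,
      hessianLip V (Metric.ball x (M.jumpBound / √(n : ℝ))) ≠ ∞ ∧
      ‖fderiv ℝ (fderiv ℝ V) x‖ * (1 + ‖x‖) ≤ C * V x ∧
      (hessianLip V (Metric.ball x (M.jumpBound / √(n : ℝ)))).toReal * (1 + ‖x‖) ≤ C * V x := by
  obtain ⟨C, hC, h⟩ := h
  refine ⟨C, hC, fun n hn x => ?_⟩
  have hx : 0 < 1 + ‖x‖ := by positivity
  have hCV : 0 ≤ C * V x := mul_nonneg hC.le (hV x)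
  have aux : ∀ a : ℝ≥0∞, a * ENNReal.ofReal (1 + ‖x‖) ≤ ENNReal.ofReal (C * V x) →
      a.toReal * (1 + ‖x‖) ≤ C * V x := by
    intro a ha
    have := ENNReal.toReal_mono ENNReal.ofReal_ne_top ha
    rwa [ENNReal.toReal_mul, ENNReal.toReal_ofReal hx.le, ENNReal.toReal_ofReal hCV] at this
  have hH := (mul_le_mul_left (le_add_self (a := hessianLip V _)) _).trans (h n hn x)
  have hD := (mul_le_mul_left (le_add_self.trans le_self_add) _).trans (h n hn x)
  refine ⟨?_, ?_, aux _ hH⟩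
  -- Since $1+|x|>0$, an infinite seminorm would make the left side of the condition infinite.
  · intro htop
    rw [htop, ENNReal.top_mul (by simpa using hx)] at hH
    exact ENNReal.ofReal_ne_top (top_le_iff.1 hH)
  · have := aux _ hD
    rwa [toReal_enorm] at this

/-- The generator of the scaled chain differs from that of the diffusion by `O(1 / √n)`,
relative to a function satisfying the derivative condition. -/
theorem exists_chain_generator_le {M : ChainSeq d} (hM : M.Base) {V : Euc d → ℝ}
    (hVC : ContDiff ℝ 2 V) (hV : ∀ x, 0 ≤ V x) (hderiv : M.DerivCondition V) :
    ∃ c : ℝ, ∀ᶠ n : ℕ in Filter.atTop, M.Index n → ∀ x : M.E n,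
      Summable (fun y : M.E n => (CTMC.offDiag (M.rate n) x y).toReal * V (M.scale n y)) ∧
      ∑' y : M.E n, (CTMC.offDiag (M.rate n) x y).toReal * V (M.scale n y) ≤
        (CTMC.exitRate (M.rate n) x).toReal * V (M.scale n x) + M.gen n V (M.scale n x) +
          c / √(n : ℝ) * V (M.scale n x) := by
  obtain ⟨C, hC, hbounds⟩ := hderiv.exists_bounds hV
  obtain ⟨Ka, hKa0, hKa⟩ := hM.exists_abar_sub_le
  obtain ⟨T, hT0, hT⟩ := hM.exists_abar_zero_le
  -- The first summand pays for replacing $\bar a^n(z)$ by $\bar a^n(0)$ in all $d^2$ entries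
  -- (`herr1`). The second pays for the Taylor remainder, with $d(T+K_a)(1+|z|)$ bounding the trace
  -- (`herr2`, `herr3`).
  refine ⟨1 / 2 * (d * (d * (Ka * C))) + M.jumpBound * (d * (T + Ka)) * C, ?_⟩
  filter_upwards [hT] with n hTn hn x
  set z := M.scale n x with hz
  set s := √(n : ℝ) with hs
  have hs1 : 1 ≤ s := by rw [hs, Real.one_le_sqrt]; exact_mod_cast hn.1
  have hs0 : 0 < s := by linarith
  have hJ := M.jumpBound_nonneg
  obtain ⟨htop, hD, hL⟩ := hbounds n hn z
  set L := (hessianLip V (Metric.ball z (M.jumpBound / s))).toReal with hLdef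
  have hL0 : 0 ≤ L := ENNReal.toReal_nonneg
  have hDnn : 0 ≤ ‖fderiv ℝ (fderiv ℝ V) z‖ := norm_nonneg (E := Euc d →L[ℝ] Euc d →L[ℝ] ℝ) _
  have hmain := summable_and_tsum_le_of_taylor hV z (b := fun y : M.E n =>
      (CTMC.offDiag (M.rate n) x y).toReal) (κ := L * (M.jumpBound / s))
    (fun y => ENNReal.toReal_nonneg)
    (fun y : M.E n => s⁻¹ • ((y : Euc d) - x)) (hasSum_offDiag M hM hn x)
    (hasSum_scaled_drift M hM hn x) (hasSum_scaled_quadVar M hM hn x) ?_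
  · simp only [hz, hs, scale_add_smul_sub] at hmain
    refine ⟨hmain.1, hmain.2.trans ?_⟩
    simp only [← hz, ← hs, gen]
    have hzn := norm_nonneg z
    have herr1 : ∑ i, ∑ j, M.abar n z i j * fderiv ℝ (fderiv ℝ V) z (EuclideanSpace.single i 1)
          (EuclideanSpace.single j 1) ≤
        ∑ i, ∑ j, M.abar n 0 i j * fderiv ℝ (fderiv ℝ V) z (EuclideanSpace.single i 1)
          (EuclideanSpace.single j 1) + d * (d * (Ka / s * (C * V z))) := by
      have hterm : ∀ i j, M.abar n z i j * fderiv ℝ (fderiv ℝ V) z (EuclideanSpace.single i 1)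
          (EuclideanSpace.single j 1) ≤
          M.abar n 0 i j * fderiv ℝ (fderiv ℝ V) z (EuclideanSpace.single i 1)
          (EuclideanSpace.single j 1) + Ka / s * (C * V z) := by
        intro i j
        have e1 := abs_bilin_apply_le (fderiv ℝ (fderiv ℝ V) z)
          (u := EuclideanSpace.single i 1) (v := EuclideanSpace.single j 1) (by simp) (by simp)
        have e2 := hKa n hn z i j
        have e3 : (M.abar n z i j - M.abar n 0 i j) * fderiv ℝ (fderiv ℝ V) z
            (EuclideanSpace.single i 1) (EuclideanSpace.single j 1) ≤ Ka / s * (C * V z) := by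
          refine (le_abs_self _).trans ?_
          rw [abs_mul]
          refine (mul_le_mul e2 e1 (abs_nonneg _) (by positivity)).trans ?_
          rw [mul_assoc]
          refine mul_le_mul_of_nonneg_left ?_ (by positivity)
          rw [mul_comm]
          exact (mul_le_mul_of_nonneg_left (by linarith) hDnn).trans hD
        linarith
      refine (Finset.sum_le_sum fun i _ => Finset.sum_le_sum fun j _ => hterm i j).trans ?_
      simp [Finset.sum_add_distrib]
    have herr2 : ∑ i, M.abar n z i i ≤ d * ((T + Ka) * (1 + ‖z‖)) := by
      have hterm : ∀ i, M.abar n z i i ≤ (T + Ka) * (1 + ‖z‖) := by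
        intro i
        have e1 := (abs_le.1 (hKa n hn z i i)).2
        have e2 := (abs_le.1 (hTn i i)).2
        have e3 : Ka / s * ‖z‖ ≤ Ka * ‖z‖ := by gcongr; exact div_le_self hKa0 hs1
        nlinarith [mul_nonneg hT0 hzn]
      refine (Finset.sum_le_sum fun i _ => hterm i).trans ?_
      simp
    have herr3 : L * (M.jumpBound / s) * ∑ i, M.abar n z i i ≤
        M.jumpBound / s * (d * (T + Ka)) * (C * V z) := by
      calc _ ≤ L * (M.jumpBound / s) * (d * ((T + Ka) * (1 + ‖z‖))) := by gcongr
        _ = M.jumpBound / s * (d * (T + Ka)) * (L * (1 + ‖z‖)) := by ring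
        _ ≤ _ := by gcongr
    have hfinal : (1 / 2 * (d * (d * (Ka * C))) + M.jumpBound * (d * (T + Ka)) * C) / s * V z =
        1 / 2 * (d * (d * (Ka / s * (C * V z)))) +
          M.jumpBound / s * (d * (T + Ka)) * (C * V z) := by ring
    rw [hfinal]
    linarith
  · intro y hy
    obtain ⟨hyx, hjump⟩ := M.norm_scaled_jump_le hM hn.1 hy
    rw [← hs] at hjump
    -- The existence of a genuine jump forces the radius $\bar\ell/\sqrt n$ to be positive, so the
    -- degenerate empty ball does not arise.
    have hne : 0 < ‖s⁻¹ • ((y : Euc d) - x)‖ := by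
      rw [norm_pos_iff]
      exact smul_ne_zero (by positivity) (sub_ne_zero.2 hyx)
    have hr : 0 < M.jumpBound / s := hne.trans_le hjump
    have := abs_taylor_two_le hVC z (s⁻¹ • ((y : Euc d) - x)) (κ := L * (M.jumpBound / s))
      fun w hw => by
        have hw' : w ∈ Metric.closedBall z (M.jumpBound / s) :=
          Metric.closedBall_subset_closedBall hjump hw
        refine (norm_hessian_sub_le_of_hessianLip_ne_top hVC hr htop hw').trans ?_
        gcongr
        simpa [dist_eq_norm] using hw'
    have := (abs_le.1 this).2
    linarith

/-! ### From moments at time $t$ to moments of the steady state. -/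

theorem lintegral_law (M : ChainSeq d) (n : ℕ) (t : ℝ) (x : M.E n) {f : Euc d → ℝ≥0∞}
    (hf : Measurable f) :
    ∫⁻ u, f u ∂(M.law n t x) = ∑' y : M.E n, CTMC.trans (M.rate n) t x y * f (M.scale n y) := by
  rw [law, lintegral_sum_measure]
  refine tsum_congr fun y => ?_
  rw [lintegral_smul_measure, lintegral_dirac' _ hf, smul_eq_mul]

theorem IsSteadyState.nonempty {M : ChainSeq d} {n : ℕ} {ν : Measure (Euc d)}
    (hν : M.IsSteadyState n ν) : Nonempty (M.E n) := by
  by_contra hE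
  have h := hν.supported
  rw [not_nonempty_iff, Set.isEmpty_coe_sort] at hE
  have := hν.prob
  simp [Ehat, hE] at h

/-- The convergence to `ν` only sees bounded continuous functions, so it is applied to the
truncations $\min(W,m)$; monotone convergence in $m$ then removes the truncation. -/
theorem IsSteadyState.lintegral_le {M : ChainSeq d} {n : ℕ} {ν : Measure (Euc d)}
    (hν : M.IsSteadyState n ν) {W : Euc d → ℝ} (hWc : Continuous W) (hW : ∀ x, 0 ≤ W x)
    (x : M.E n) {B : ℝ → ℝ} {c : ℝ} (hB0 : ∀ t, 0 ≤ t → 0 ≤ B t)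
    (hB : Filter.Tendsto B Filter.atTop (𝓝 c))
    (hle : ∀ t, 0 ≤ t → ∫⁻ u, ENNReal.ofReal (W u) ∂(M.law n t x) ≤ ENNReal.ofReal (B t)) :
    ∫⁻ u, ENNReal.ofReal (W u) ∂ν ≤ ENNReal.ofReal c := by
  have := hν.prob
  let f : ℕ → BoundedContinuousFunction (Euc d) ℝ := fun m =>
    BoundedContinuousFunction.ofNormedAddCommGroup (fun u => min (W u) m)
      (by fun_prop) m fun u => by
        rw [Real.norm_eq_abs, abs_of_nonneg (le_min (hW u) (Nat.cast_nonneg m))]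
        exact min_le_right _ _
  have hf0 : ∀ m u, 0 ≤ f m u := fun m u => le_min (hW u) (Nat.cast_nonneg m)
  have hfW : ∀ m u, f m u ≤ W u := fun m u => min_le_left _ _
  have hbound : ∀ m, ∫⁻ u, ENNReal.ofReal (f m u) ∂ν ≤ ENNReal.ofReal c := by
    intro m
    rw [← ofReal_integral_eq_lintegral_ofReal ((f m).integrable ν) (.of_forall (hf0 m))]
    refine ENNReal.ofReal_le_ofReal (le_of_tendsto_of_tendsto (hν.tendsto x (f m)) hB ?_)
    filter_upwards [Filter.eventually_ge_atTop 0] with t ht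
    rw [integral_eq_lintegral_of_nonneg_ae (.of_forall (hf0 m))
      (f m).continuous.aestronglyMeasurable]
    refine ENNReal.toReal_le_of_le_ofReal (hB0 t ht) (le_trans ?_ (hle t ht))
    exact lintegral_mono fun u => ENNReal.ofReal_le_ofReal (hfW m u)
  refine le_of_tendsto' (lintegral_tendsto_of_tendsto_of_monotone
    (f := fun (m : ℕ) u => ENNReal.ofReal (f m u)) ?_ ?_ ?_) hbound
  · exact fun m => (ENNReal.measurable_ofReal.comp (f m).continuous.measurable).aemeasurable
  · refine .of_forall fun u m m' hm => ENNReal.ofReal_le_ofReal ?_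
    exact min_le_min_left _ (Nat.cast_le.2 hm)
  · refine .of_forall fun u => tendsto_const_nhds.congr' ?_
    obtain ⟨m₀, hm₀⟩ := exists_nat_ge (W u)
    filter_upwards [Filter.eventually_ge_atTop m₀] with m hm
    congr 1
    exact (min_eq_left (hm₀.trans (Nat.cast_le.2 hm))).symm

/-- Uniform boundedness of the steady-state moments. -/
theorem exists_eventually_lintegral_le {M : ChainSeq d} (hM : M.Base) {ν : ℕ → Measure (Euc d)}
    (hν : ∀ n, M.Index n → M.IsSteadyState n (ν n)) {V : Euc d → ℝ} (hV : M.Lyapunov V)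
    (hderiv : M.DerivCondition V) :
    ∃ c : ℝ, ∀ᶠ n in Filter.atTop, ∫⁻ x, ENNReal.ofReal (V x) ∂(ν n) ≤ ENNReal.ofReal c := by
  have hV0 : ∀ x, 0 ≤ V x := fun x => zero_le_one.trans (hV.subExponential.one_le x)
  obtain ⟨b, δ, K, hb, hδ, -, hdrift⟩ := hV.drift
  obtain ⟨c, hc⟩ := exists_chain_generator_le hM hV.subExponential.contDiff hV0 hderiv
  have hsqrt : Filter.Tendsto (fun n : ℕ => √(n : ℝ)) Filter.atTop Filter.atTop :=
    Real.tendsto_sqrt_atTop.comp tendsto_natCast_atTop_atTop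
  have hsmall : ∀ a ε : ℝ, 0 < ε → ∀ᶠ n : ℕ in Filter.atTop, a / √(n : ℝ) ≤ ε := fun a ε hε =>
    (hsqrt.const_div_atTop a).eventually (eventually_le_nhds hε)
  -- Decay at rate $\delta/2$ survives once the error $c/\sqrt n$ is at most $\delta/2$; against the
  -- constant input $b$ the equilibrium level is $b/(\delta/2)$.
  refine ⟨b / (δ / 2), ?_⟩
  filter_upwards [hc, hsmall c (δ / 2) (half_pos hδ), hsmall M.jumpBound 1 one_pos,
    Filter.eventually_ge_atTop 1] with n hgen hcn hJn hn1
  have hn : M.Index n := ⟨hn1, hJn⟩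
  obtain ⟨x⟩ := (hν n hn).nonempty
  have hreal : ∀ x : M.E n,
      ∑' y : M.E n, (CTMC.offDiag (M.rate n) x y).toReal * V (M.scale n y) ≤
        ((CTMC.exitRate (M.rate n) x).toReal - δ / 2) * V (M.scale n x) +
          δ / 2 * (b / (δ / 2)) := by
    intro x
    have h1 := (hgen hn x).2
    have h2 := hdrift n hn (M.scale n x)
    have h3 : (Metric.closedBall (0 : Euc d) K).indicator (fun _ => b) (M.scale n x) ≤ b :=
      Set.indicator_apply_le' (fun _ => le_rfl) fun _ => hb.le
    have h4 := mul_le_mul_of_nonneg_right hcn (hV0 (M.scale n x))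
    rw [mul_div_cancel₀ b (half_pos hδ).ne']
    linarith
  have htrans := fun (t : ℝ) (ht : 0 ≤ t) => CTMC.tsum_trans_mul_le
    (W := fun y : M.E n => V (M.scale n y)) (hM.exitRate_lt_top n hn) (fun y => hV0 _)
    (half_pos hδ) (c := b / (δ / 2)) (by positivity)
    -- The sign condition is automatic: the drift inequality bounds a nonnegative sum.
    (fun x => (tsum_nonneg fun y => mul_nonneg ENNReal.toReal_nonneg (hV0 _)).trans (hreal x))
    (fun x => by
      refine le_trans (le_of_eq ?_) (ENNReal.ofReal_le_ofReal (hreal x))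
      rw [ENNReal.ofReal_tsum_of_nonneg
        (fun y => mul_nonneg ENNReal.toReal_nonneg (hV0 _)) (hgen hn x).1]
      refine tsum_congr fun y => ?_
      rw [ENNReal.ofReal_mul ENNReal.toReal_nonneg, ENNReal.ofReal_toReal]
      exact ne_top_of_le_ne_top (hM.exitRate_lt_top n hn x).ne (ENNReal.le_tsum y)) ht x
  have hcont : Continuous V := hV.subExponential.contDiff.continuous
  refine (hν n hn).lintegral_le hcont hV0 x
    (B := fun t => Real.exp (-(δ / 2 * t)) * V (M.scale n x) +
      b / (δ / 2) * (1 - Real.exp (-(δ / 2 * t)))) ?_ ?_ ?_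
  · intro t ht
    have h1 : Real.exp (-(δ / 2 * t)) ≤ 1 := Real.exp_le_one_iff.2 (by nlinarith)
    have h2 := hV0 (M.scale n x)
    have h3 : 0 ≤ 1 - Real.exp (-(δ / 2 * t)) := by linarith
    positivity
  · have h1 : Filter.Tendsto (fun t : ℝ => Real.exp (-(δ / 2 * t))) Filter.atTop (𝓝 0) :=
      Real.tendsto_exp_neg_atTop_nhds_zero.comp
        (Filter.tendsto_id.const_mul_atTop (half_pos hδ))
    simpa using (h1.mul_const (V (M.scale n x))).add ((h1.const_sub 1).const_mul (b / (δ / 2)))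
  · intro t ht
    rw [lintegral_law M n t x (f := fun u => ENNReal.ofReal (V u))
      (ENNReal.measurable_ofReal.comp hcont.measurable)]
    exact htrans t ht

end ChainSeq

theorem corollary3p4 {d : ℕ} (M : ChainSeq d) (hM : M.Base)
    (ν : ℕ → MeasureTheory.Measure (Euc d)) (hν : ∀ n, M.Index n → M.IsSteadyState n (ν n))
    (V Vbar : Euc d → ℝ) (hV : M.Lyapunov V) (hVbar : M.Lyapunov Vbar)
    (hderiv : M.DerivCondition Vbar) (hle : ∀ x, V x * (1 + ‖x‖) ^ 4 ≤ Vbar x) :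
    Filter.limsup (fun n => ∫⁻ x, ENNReal.ofReal (Vbar x) ∂(ν n)) Filter.atTop < ∞ ∧
      Filter.limsup (fun n => ∫⁻ x, ENNReal.ofReal (V x * (1 + ‖x‖) ^ 4) ∂(ν n))
        Filter.atTop < ∞ := by
  obtain ⟨c, hc⟩ := ChainSeq.exists_eventually_lintegral_le hM hν hVbar hderiv
  have hc' : ∀ᶠ n in Filter.atTop,
      ∫⁻ x, ENNReal.ofReal (V x * (1 + ‖x‖) ^ 4) ∂(ν n) ≤ ENNReal.ofReal c :=
    hc.mono fun n hn =>
      (MeasureTheory.lintegral_mono fun x => ENNReal.ofReal_le_ofReal (hle x)).trans hn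
  exact ⟨(Filter.limsup_le_of_le (by isBoundedDefault) hc).trans_lt ENNReal.ofReal_lt_top,
    (Filter.limsup_le_of_le (by isBoundedDefault) hc').trans_lt ENNReal.ofReal_lt_top⟩
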